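/- Let $n,r\ge 0$ be integers with $r\le n/2$. For $x\in\{0,1\}^n$ let $|x|$ be the Hamming weight of $x$ (the number of its nonzero coordinates), let $S(n,i)=\{x\in\{0,1\}^n:|x|=i\}$, and let $B(n,r)=\bigcup_{i=0}^r S(n,i)$. Let $A$ be the (real) adjacency matrix of the subgraph induced on $B(n,r)$ by the graph on $\{0,1\}^n$ in which two points are adjacent iff their Hamming distance is $1$; $A$ acts on $\mathbb{R}^{B(n,r)}$. For integers $m,k\ge 0$ let $$K^{(m)}_k(x)=\sum_{\ell=0}^k(-1)^\ell\binom{x}{\ell}\binom{m-x}{k-\ell}$$ be the Krawtchouk polynomial, where $\binom{x}{\ell}=x(x-1)\cdots(x-\ell+1)/\ell!$ as a polynomial in $x$, and let $\mathcal{R}(m,k)\subset\mathbb{R}$ be the set of its real roots. For $0\le t\le r$ let $$\Lambda_t=2\cdot\mathcal{R}(n-2t,\,r-t+1)-(n-2t)=\{2x-(n-2t):x\in\mathcal{R}(n-2t,r-t+1)\}.$$ For $0\le j\le i\le n/2$ let $U_j\subseteq\mathbb{R}^{S(n,i)}$ be the span of the functions $g_z$, $z\in\{0,1\}^n$, $|z|\le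 j$, where $g_z(x)=1$ if $z_k\le x_k$ for every $k$ and $g_z(x)=0$ otherwise. The $t$-th eigenspace $V_t$ of the Johnson scheme on $S(n,i)$ is $V_0=U_0$ for $t=0$, and $V_t=U_t\cap U_{t-1}^{\perp}$ for $1\le t\le i$, the orthogonal complement being taken for the inner product $\langle f,g\rangle=\sum_x f(x)g(x)$. Put $\binom{n}{-1}=0$. Then the following hold. 1. For each $t=0,\dots,r$ the set $\Lambda_t$ consists of exactly $r-t+1$ distinct real numbers, and for each $\lambda\in\Lambda_t$ there is a linear space $W_t(\lambda)$, of dimension $\binom{n}{t}-\binom{n}{t-1}$, of functions $f:B(n,r)\to\mathbb{R}$ with $Af=\lambda f$; these spaces can be chosen to have the properties in part 3. 2. A real number $\lambda$ is an eigenvalue of $A$ if and only if $\lambda\in\bigcup_{t=0}^r\Lambda_t$, and its multiplicity as an eigenvalue of $A$ (the dimension of $\{f:Af=\lambda f\}$) is $$m(\lambda)=\sum_{0\le t\le r,\ \lambda\in\Lambda_t}\left(\binom{n}{t}-\binom{n}{t-1}\right).$$ 3. Let $0\le t\le r$, $\lambda\in\Lambda_t$ and $f\in W_t(\lambda)$.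 Then $f$ vanishes at every $x\in B(n,r)$ with $|x|<t$, and for each $i$ with $t\le i\le r$ the restriction of $f$ to $S(n,i)$ lies in the $t$-th eigenspace $V_t$ of $S(n,i)$. The restrictions to $S(n,t)$ of the functions in $W_t(\lambda)$ form the whole $t$-th eigenspace $V_t$ of $S(n,t)$. Moreover, a function in $W_t(\lambda)$ is determined by its restriction to $S(n,t)$: two functions in $W_t(\lambda)$ that agree on $S(n,t)$ are equal. -/

import Mathlib

/-- The Hamming cube `{0,1}^n`. -/
abbrev HCube (n : ℕ) : Type := Fin n → Bool

/-- The Hamming weight `|x|`, i.e. the Hamming distance of `x` from `0`. -/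
def hWeight {n : ℕ} (x : HCube n) : ℕ := hammingDist x (fun _ => false)

/-- The Hamming cube as a graph: two points are adjacent iff their Hamming distance is `1`. -/
def hGraph (n : ℕ) : SimpleGraph (HCube n) where
  Adj x y := hammingDist x y = 1
  symm := ⟨fun x y h => by rw [hammingDist_comm]; exact h⟩
  loopless := ⟨fun x h => by simp at h⟩

instance (n : ℕ) : DecidableRel (hGraph n).Adj :=
  fun x y => inferInstanceAs (Decidable (hammingDist x y = 1))

/-- The Hamming sphere `S(n,i)` of radius `i` around `0`. -/
def hSphere (n i : ℕ) : Set (HCube n) := {x | hWeight x = i}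

/-- The Hamming ball `B(n,r)` of radius `r` around `0`. -/
def hBall (n r : ℕ) : Set (HCube n) := {x | hWeight x ≤ r}

instance (n i : ℕ) : DecidablePred (· ∈ hSphere n i) :=
  fun x => inferInstanceAs (Decidable (hWeight x = i))

instance (n r : ℕ) : DecidablePred (· ∈ hBall n r) :=
  fun x => inferInstanceAs (Decidable (hWeight x ≤ r))

theorem hSphere_subset_hBall (n : ℕ) {i r : ℕ} (h : i ≤ r) : hSphere n i ⊆ hBall n r := by
  intro x hx
  have hx' : hWeight x = i := hx
  exact (hx'.trans_le h : hWeight x ≤ r)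

/-- The adjacency matrix `A(n,r)` of the subgraph of the cube induced by the ball `B(n,r)`. -/
def hBallAdj (n r : ℕ) : Matrix (hBall n r) (hBall n r) ℝ :=
  ((hGraph n).induce (hBall n r)).adjMatrix ℝ

/-- `A(n,r)` as a linear operator on the real functions on the ball. -/
noncomputable def hBallOp (n r : ℕ) : Module.End ℝ (hBall n r → ℝ) :=
  Matrix.toLin' (hBallAdj n r)

/-- Restriction of functions from the ball `B(n,r)` to the sphere `S(n,i)`, where `i ≤ r`. -/
def restrictSphere (n : ℕ) {i r : ℕ} (h : i ≤ r) :
    (hBall n r → ℝ) →ₗ[ℝ] (hSphere n i → ℝ) :=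
  LinearMap.funLeft ℝ ℝ (Set.inclusion (hSphere_subset_hBall n h))

/-- The function `g_z` on `S(n,i)`: the indicator of `z ⊆ x`. -/
def gFun (n i : ℕ) (z : HCube n) : hSphere n i → ℝ :=
  fun x => if ∀ k, z k = true → x.1 k = true then 1 else 0

/-- `U_j`, the span of the functions `g_z` on `S(n,i)` with `|z| ≤ j`. -/
def johnsonU (n i j : ℕ) : Submodule ℝ (hSphere n i → ℝ) :=
  Submodule.span ℝ (gFun n i '' {z | hWeight z ≤ j})

/-- The orthogonal complement of a space of functions, for `⟨f, g⟩ = ∑ x, f x * g x`. -/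
def orthCompl {ι : Type*} [Fintype ι] (U : Submodule ℝ (ι → ℝ)) : Submodule ℝ (ι → ℝ) where
  carrier := {f | ∀ g ∈ U, ∑ x, f x * g x = 0}
  zero_mem' := by intro g _; simp
  add_mem' := by
    intro a b ha hb g hg
    have h1 := ha g hg
    have h2 := hb g hg
    simp only [Pi.add_apply, add_mul, Finset.sum_add_distrib, h1, h2, add_zero]
  smul_mem' := by
    intro c a ha g hg
    have h1 := ha g hg
    simp only [Pi.smul_apply, smul_eq_mul, mul_assoc, ← Finset.mul_sum, h1, mul_zero]

/-- The `j`-th eigenspace `V_j` of the Johnson scheme on `S(n,i)`: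
`V_0 = U_0` and `V_j = U_j ∩ (U_{j-1})^⊥` for `j ≥ 1`. -/
def johnsonV (n i : ℕ) : ℕ → Submodule ℝ (hSphere n i → ℝ)
  | 0 => johnsonU n i 0
  | j + 1 => johnsonU n i (j + 1) ⊓ orthCompl (johnsonU n i j)

/-- The polynomial `binom(x, l) = x (x - 1) ⋯ (x - l + 1) / l!`. -/
noncomputable def binomPoly (l : ℕ) : Polynomial ℝ :=
  Polynomial.C ((l.factorial : ℝ)⁻¹) * descPochhammer ℝ l

/-- The Krawtchouk polynomial
`K^{(m)}_k(x) = ∑_{l=0}^k (-1)^l binom(x, l) binom(m - x, k - l)`. -/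
noncomputable def krawtchouk (m k : ℕ) : Polynomial ℝ :=
  ∑ l ∈ Finset.range (k + 1),
    (-1) ^ l * binomPoly l * (binomPoly (k - l)).comp (Polynomial.C (m : ℝ) - Polynomial.X)

/-- The set `R(m,k)` of roots of `K^{(m)}_k`. -/
def krawtchoukRoots (m k : ℕ) : Set ℝ := {x | (krawtchouk m k).IsRoot x}

/-- `Λ_t = 2 R(n - 2t, r - t + 1) - (n - 2t)`, used for `t ≤ r ≤ n / 2` only. -/
def ballLambda (n r t : ℕ) : Set ℝ :=
  (fun x : ℝ => 2 * x - ((n : ℝ) - 2 * (t : ℝ))) '' krawtchoukRoots (n - 2 * t) (r - t + 1)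

/-- `binom(n, t) - binom(n, t - 1)`, where `binom(n, -1) = 0`. -/
def binomDiff (n : ℕ) : ℕ → ℤ
  | 0 => (n.choose 0 : ℤ)
  | t + 1 => (n.choose (t + 1) : ℤ) - (n.choose t : ℤ)

open Classical in
/-- The sum of `binom(n, t) - binom(n, t - 1)` over all `t ∈ {0, …, r}` with `μ ∈ Λ_t`. -/
noncomputable def lambdaDimSum (n r : ℕ) (μ : ℝ) : ℤ :=
  ∑ t ∈ (Finset.range (r + 1)).filter (fun t => μ ∈ ballLambda n r t), binomDiff n t

/-! On functions on the cube let U sum over lower neighbours and D over upper ones. They are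
adjoint, and DU - UD multiplies by n - 2|x|. If h lives on S(n,t) and Dh = 0 ("harmonic"), then D
U^(i+1) h = (i+1)(m-i) U^i h with m = n - 2t. For functions supported on the ball, A is U + D
followed by restriction to the ball, so on h, Uh, ..., U^(r-t) h it acts as a tridiagonal matrix.
Its characteristic polynomial is the monic P_(r-t+1) given by P_(k+2) = X P_(k+1) - (k+1)(m-k) P_k
(`krawtchoukMonic`), a rescaled Krawtchouk polynomial in 2x - m. The numbers (k+1)(m-k) that occur
are positive because 2r ≤ n, so P_(r-t+1) has r-t+1 distinct real roots. Each root μ turns every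
harmonic h into an eigenfunction, and W_t(μ) is the image of the harmonic space
(`ballW_le_eigenspace`).

The harmonic space has dimension binom(n,t) - binom(n,t-1), since D maps level t onto level t-1, and
it corresponds to V_t on S(n,t). Powers of U carry it into V_t on the higher spheres.

Completeness is by counting. For fixed μ the spaces W_t(μ) are independent, so each multiplicity is
at least m(μ). The numbers m(μ) add up to |B(n,r)|, so all these inequalities are equalities
(`finrank_eigenspace_hBallOp`). -/

section Cube

/-! ### Raising and lowering operators, and harmonic functions. -/

variable {n : ℕ}

/-- The point of the cube obtained from `x` by changing the coordinate `k`. -/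
def cubeFlip (k : Fin n) (x : HCube n) : HCube n := Function.update x k (!x k)

@[simp] theorem cubeFlip_same (k : Fin n) (x : HCube n) : cubeFlip k x k = !x k := by
  simp [cubeFlip]

theorem cubeFlip_of_ne {k l : Fin n} (h : l ≠ k) (x : HCube n) : cubeFlip k x l = x l := by
  simp [cubeFlip, h]

@[simp] theorem cubeFlip_cubeFlip (k : Fin n) (x : HCube n) : cubeFlip k (cubeFlip k x) = x := by
  funext l
  by_cases h : l = k
  · subst h; simp
  · simp [cubeFlip_of_ne h]

theorem cubeFlip_comm (k l : Fin n) (x : HCube n) :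
    cubeFlip k (cubeFlip l x) = cubeFlip l (cubeFlip k x) := by
  by_cases h : k = l
  · rw [h]
  · funext j
    by_cases h1 : j = k
    · subst h1; simp [cubeFlip_of_ne h]
    · by_cases h2 : j = l
      · subst h2; simp [cubeFlip_of_ne h1]
      · simp [cubeFlip_of_ne h1, cubeFlip_of_ne h2]

theorem cubeFlip_involutive (k : Fin n) : Function.Involutive (cubeFlip k) := cubeFlip_cubeFlip k

theorem hWeight_eq_card (x : HCube n) : hWeight x = {k | x k = true}.ncard := by
  simp [hWeight, hammingDist, ← Set.ncard_coe_finset]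

theorem hWeight_eq_sum (x : HCube n) : (hWeight x : ℝ) = ∑ k, if x k = true then 1 else 0 := by
  simp [hWeight, hammingDist]

theorem hWeight_cubeFlip_of_false {k : Fin n} {x : HCube n} (h : x k = false) :
    hWeight (cubeFlip k x) = hWeight x + 1 := by
  rw [hWeight_eq_card, hWeight_eq_card, ← Set.ncard_insert_of_notMem (a := k) (by simp [h])]
  congr 1
  ext l
  by_cases hl : l = k
  · subst hl; simp [h]
  · simp [hl, cubeFlip_of_ne hl]

theorem hWeight_cubeFlip_of_true {k : Fin n} {x : HCube n} (h : x k = true) :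
    hWeight (cubeFlip k x) + 1 = hWeight x := by
  rw [← hWeight_cubeFlip_of_false (k := k) (x := cubeFlip k x) (by simp [h]), cubeFlip_cubeFlip]

theorem hammingDist_eq_one_iff (x y : HCube n) :
    hammingDist x y = 1 ↔ ∃ k, y = cubeFlip k x := by
  rw [hammingDist, Finset.card_eq_one]
  refine exists_congr fun k => ?_
  constructor
  · intro h
    funext l
    have hl : x l ≠ y l ↔ l = k := by
      simpa using congrArg (l ∈ ·) h
    by_cases hlk : l = k
    · subst hlk
      have := hl.2 rfl
      rw [cubeFlip_same]
      revert this; cases x l <;> cases y l <;> simp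
    · rw [cubeFlip_of_ne hlk]
      by_contra hne
      exact hlk (hl.1 fun e => hne e.symm)
  · rintro rfl
    ext l
    by_cases hlk : l = k
    · subst hlk; simp
    · simp [hlk, cubeFlip_of_ne hlk]

theorem cubeFlip_injective_left (x : HCube n) : Function.Injective fun k => cubeFlip k x := by
  intro k l h
  by_contra hne
  have := congrFun h k
  simp [cubeFlip_of_ne hne] at this

/-- The raising operator on functions on the cube: summation over the lower neighbours. -/
def cubeUp (n : ℕ) : Module.End ℝ (HCube n → ℝ) where
  toFun f x := ∑ k, if x k = true then f (cubeFlip k x) else 0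
  map_add' f g := by
    funext x
    simp only [Pi.add_apply, ← Finset.sum_add_distrib]
    exact Finset.sum_congr rfl fun k _ => by split_ifs <;> simp
  map_smul' c f := by
    funext x
    simp only [Pi.smul_apply, smul_eq_mul, Finset.mul_sum, RingHom.id_apply]
    exact Finset.sum_congr rfl fun k _ => by split_ifs <;> simp

/-- The lowering operator on functions on the cube: summation over the upper neighbours. -/
def cubeDown (n : ℕ) : Module.End ℝ (HCube n → ℝ) where
  toFun f x := ∑ k, if x k = true then 0 else f (cubeFlip k x)
  map_add' f g := by
    funext x
    simp only [Pi.add_apply, ← Finset.sum_add_distrib]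
    exact Finset.sum_congr rfl fun k _ => by split_ifs <;> simp
  map_smul' c f := by
    funext x
    simp only [Pi.smul_apply, smul_eq_mul, Finset.mul_sum, RingHom.id_apply]
    exact Finset.sum_congr rfl fun k _ => by split_ifs <;> simp

theorem cubeUp_apply (f : HCube n → ℝ) (x : HCube n) :
    cubeUp n f x = ∑ k, if x k = true then f (cubeFlip k x) else 0 := rfl

theorem cubeDown_apply (f : HCube n → ℝ) (x : HCube n) :
    cubeDown n f x = ∑ k, if x k = true then 0 else f (cubeFlip k x) := rfl

theorem cubeUp_add_cubeDown_apply (f : HCube n → ℝ) (x : HCube n) :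
    cubeUp n f x + cubeDown n f x = ∑ k, f (cubeFlip k x) := by
  rw [cubeUp_apply, cubeDown_apply, ← Finset.sum_add_distrib]
  exact Finset.sum_congr rfl fun k _ => by split_ifs <;> simp

theorem sum_cubeUp_mul (f g : HCube n → ℝ) :
    ∑ x, cubeUp n f x * g x = ∑ x, f x * cubeDown n g x := by
  simp only [cubeUp_apply, cubeDown_apply, Finset.sum_mul, Finset.mul_sum]
  rw [Finset.sum_comm, Finset.sum_comm (s := Finset.univ (α := HCube n))]
  refine Finset.sum_congr rfl fun k _ => ?_
  rw [← Equiv.sum_comp (cubeFlip_involutive k).toPerm]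
  refine Finset.sum_congr rfl fun x _ => ?_
  cases h : x k <;> simp [h]

theorem cubeDown_cubeUp_apply (f : HCube n → ℝ) (x : HCube n) :
    cubeDown n (cubeUp n f) x = cubeUp n (cubeDown n f) x + ((n : ℝ) - 2 * hWeight x) * f x := by
  have key : cubeDown n (cubeUp n f) x - cubeUp n (cubeDown n f) x =
      ∑ k, (if x k = true then -f x else f x) := by
    have h1 : cubeDown n (cubeUp n f) x = ∑ k, ∑ l, (if l = k then
        (if x k = true then 0 else f x) else
        if x k = true then 0 else if x l = true then f (cubeFlip l (cubeFlip k x)) else 0) := by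
      rw [cubeDown_apply]
      refine Finset.sum_congr rfl fun k _ => ?_
      cases h : x k
      · simp only [cubeUp_apply]
        refine Finset.sum_congr rfl fun l _ => ?_
        by_cases hl : l = k
        · subst hl; simp [h]
        · simp [hl, cubeFlip_of_ne hl]
      · simp
    have h2 : cubeUp n (cubeDown n f) x = ∑ k, ∑ l, (if l = k then
        (if x k = true then f x else 0) else
        if x k = true then if x l = true then 0 else f (cubeFlip l (cubeFlip k x)) else 0) := by
      rw [cubeUp_apply]
      refine Finset.sum_congr rfl fun k _ => ?_
      cases h : x k
      · simp
      · simp only [cubeDown_apply]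
        refine Finset.sum_congr rfl fun l _ => ?_
        by_cases hl : l = k
        · subst hl; simp [h]
        · simp [hl, cubeFlip_of_ne hl]
    -- Exchanging the two flips in one double sum matches the off-diagonal terms, which cancel
    -- because flips commute; only the diagonal survives.
    rw [h1, h2, Finset.sum_comm, ← Finset.sum_sub_distrib]
    refine Finset.sum_congr rfl fun k _ => ?_
    rw [← Finset.sum_sub_distrib, Finset.sum_eq_single k]
    · simp; split_ifs <;> simp
    · intro l _ hl
      simp only [hl, hl.symm, if_false]
      cases x k <;> cases x l <;> simp [cubeFlip_comm]
    · simp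
  have hs : ∑ k, (if x k = true then -f x else f x) = ((n : ℝ) - 2 * hWeight x) * f x := by
    rw [hWeight_eq_sum]
    have : (n : ℝ) = ∑ _k : Fin n, 1 := by simp
    rw [this, Finset.mul_sum, ← Finset.sum_sub_distrib, Finset.sum_mul]
    exact Finset.sum_congr rfl fun k _ => by split_ifs <;> ring
  linarith

/-- The functions on the cube supported on the sphere `S(n,t)`. -/
def cubeLevel (n t : ℕ) : Submodule ℝ (HCube n → ℝ) where
  carrier := {f | ∀ x, hWeight x ≠ t → f x = 0}
  zero_mem' := by intro x _; rfl
  add_mem' := by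
    intro a b ha hb x hx
    simp [ha x hx, hb x hx]
  smul_mem' := by
    intro c a ha x hx
    simp [ha x hx]

/-- The functions on `S(n,t)` annihilated by the lowering operator. -/
def cubeHarmonic (n t : ℕ) : Submodule ℝ (HCube n → ℝ) :=
  cubeLevel n t ⊓ LinearMap.ker (cubeDown n)

theorem cubeUp_mem_cubeLevel {t : ℕ} {f : HCube n → ℝ} (hf : f ∈ cubeLevel n t) :
    cubeUp n f ∈ cubeLevel n (t + 1) := by
  intro x hx
  rw [cubeUp_apply]
  refine Finset.sum_eq_zero fun k _ => ?_
  split_ifs with h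
  · exact hf _ fun e => hx (by rw [← hWeight_cubeFlip_of_true h, e])
  · rfl

theorem cubeDown_mem_cubeLevel {t : ℕ} {f : HCube n → ℝ} (hf : f ∈ cubeLevel n (t + 1)) :
    cubeDown n f ∈ cubeLevel n t := by
  intro x hx
  rw [cubeDown_apply]
  refine Finset.sum_eq_zero fun k _ => ?_
  split_ifs with h
  · rfl
  · refine hf _ fun e => hx ?_
    rw [hWeight_cubeFlip_of_false (by simpa using h)] at e
    omega

theorem cubeLevel_zero_le_ker : cubeLevel n 0 ≤ LinearMap.ker (cubeDown n) := by
  intro f hf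
  rw [LinearMap.mem_ker]
  funext x
  rw [cubeDown_apply]
  refine Finset.sum_eq_zero fun k _ => ?_
  split_ifs with h
  · rfl
  · refine hf _ ?_
    rw [hWeight_cubeFlip_of_false (by simpa using h)]
    omega

theorem pow_cubeUp_mem_cubeLevel {t : ℕ} {f : HCube n → ℝ} (hf : f ∈ cubeLevel n t) (i : ℕ) :
    (cubeUp n ^ i) f ∈ cubeLevel n (t + i) := by
  induction i with
  | zero => simpa using hf
  | succ i ih =>
    rw [pow_succ', Module.End.mul_apply]
    exact cubeUp_mem_cubeLevel ih

theorem cubeDown_cubeUp_of_mem {t : ℕ} {f : HCube n → ℝ} (hf : f ∈ cubeLevel n t) :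
    cubeDown n (cubeUp n f) = cubeUp n (cubeDown n f) + ((n : ℝ) - 2 * t) • f := by
  funext x
  rw [cubeDown_cubeUp_apply, Pi.add_apply, Pi.smul_apply, smul_eq_mul]
  by_cases hx : hWeight x = t
  · rw [hx]
  · rw [hf x hx]; ring

/-- Each exchange of D and U on level t + s contributes n - 2(t + s); summing over s = 0, ..., i
gives the factor. These are the products of opposite off-diagonal entries of the tridiagonal matrix.
-/
theorem cubeDown_pow_cubeUp {t : ℕ} {h : HCube n → ℝ} (hh : h ∈ cubeHarmonic n t) (i : ℕ) :
    cubeDown n ((cubeUp n ^ (i + 1)) h) =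
      (((i : ℝ) + 1) * ((n : ℝ) - 2 * t - i)) • (cubeUp n ^ i) h := by
  induction i with
  | zero =>
    have h0 : cubeDown n h = 0 := hh.2
    simp [cubeDown_cubeUp_of_mem hh.1, h0]
  | succ i ih =>
    rw [pow_succ', Module.End.mul_apply, cubeDown_cubeUp_of_mem (pow_cubeUp_mem_cubeLevel hh.1 _),
      ih, map_smul, ← Module.End.mul_apply, ← pow_succ', ← add_smul]
    congr 1
    push_cast
    ring

theorem card_hWeight_eq (n t : ℕ) :
    (Finset.univ.filter fun x : HCube n => hWeight x = t).card = n.choose t := by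
  have : n.choose t = (Finset.powersetCard t (Finset.univ : Finset (Fin n))).card := by simp
  rw [this]
  refine Finset.card_bij' (fun x _ => Finset.univ.filter fun k => x k = true)
    (fun s _ k => decide (k ∈ s)) ?_ ?_ ?_ ?_
  · intro x hx
    simpa [Finset.mem_powersetCard, hWeight, hammingDist] using hx
  · intro s hs
    simpa [Finset.mem_powersetCard, hWeight, hammingDist] using hs
  · intro x _
    funext k
    simp
  · intro s _
    ext k
    simp

theorem card_hSphere (n t : ℕ) : Fintype.card (hSphere n t) = n.choose t := by
  rw [← card_hWeight_eq, Fintype.card_subtype]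
  rfl

theorem card_hBall (n r : ℕ) : Fintype.card (hBall n r) = ∑ t ∈ Finset.range (r + 1), n.choose t := by
  have h1 : Fintype.card (hBall n r) = (Finset.univ.filter fun x : HCube n => hWeight x ≤ r).card := by
    rw [Fintype.card_subtype]; rfl
  rw [h1, Finset.card_eq_sum_card_fiberwise (f := hWeight) (t := Finset.range (r + 1))]
  · refine Finset.sum_congr rfl fun t ht => ?_
    rw [← card_hWeight_eq, Finset.filter_filter]
    congr 1
    refine Finset.filter_congr fun x _ => ?_
    rw [Finset.mem_range] at ht
    omega
  · intro x hx
    simp at hx ⊢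
    omega

/-- Restriction of functions from the cube to the sphere `S(n,i)`. -/
def cubeToSphere (n i : ℕ) : (HCube n → ℝ) →ₗ[ℝ] (hSphere n i → ℝ) :=
  LinearMap.funLeft ℝ ℝ Subtype.val

/-- Extension by zero of functions from the sphere `S(n,t)` to the cube. -/
def sphereExtend {t : ℕ} (f : hSphere n t → ℝ) : HCube n → ℝ :=
  fun x => if h : x ∈ hSphere n t then f ⟨x, h⟩ else 0

theorem sphereExtend_mem {t : ℕ} (f : hSphere n t → ℝ) : sphereExtend f ∈ cubeLevel n t := by
  intro x hx
  exact dif_neg hx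

theorem cubeToSphere_sphereExtend {t : ℕ} (f : hSphere n t → ℝ) :
    cubeToSphere n t (sphereExtend f) = f := by
  funext x
  exact dif_pos x.2

theorem cubeToSphere_injOn (n t : ℕ) :
    Set.InjOn (cubeToSphere n t) (cubeLevel n t : Set (HCube n → ℝ)) := by
  intro f hf g hg h
  funext x
  by_cases hx : hWeight x = t
  · exact congrFun h ⟨x, hx⟩
  · rw [hf x hx, hg x hx]

theorem finrank_cubeLevel (n t : ℕ) : Module.finrank ℝ (cubeLevel n t) = n.choose t := by
  have e : cubeLevel n t ≃ₗ[ℝ] (hSphere n t → ℝ) :=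
    LinearEquiv.ofBijective ((cubeToSphere n t).domRestrict (cubeLevel n t))
      ⟨fun f g h => Subtype.ext (cubeToSphere_injOn n t f.2 g.2 h),
        fun f => ⟨⟨_, sphereExtend_mem f⟩, cubeToSphere_sphereExtend f⟩⟩
  rw [e.finrank_eq, Module.finrank_fintype_fun_eq_card, card_hSphere]

/-- Pairing with f gives ⟨DUf, f⟩ = ‖Df‖² + (n - 2t)‖f‖², which is positive unless f = 0. -/
theorem cubeDown_cubeUp_eq_zero {t : ℕ} (ht : 2 * t < n) {f : HCube n → ℝ}
    (hf : f ∈ cubeLevel n t) (h : cubeDown n (cubeUp n f) = 0) : f = 0 := by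
  have h1 : ∑ x, cubeDown n f x * cubeDown n f x + ((n : ℝ) - 2 * t) * ∑ x, f x * f x = 0 := by
    rw [← sum_cubeUp_mul, Finset.mul_sum, ← Finset.sum_add_distrib]
    refine Finset.sum_eq_zero fun x _ => ?_
    have := congrFun (cubeDown_cubeUp_of_mem hf) x
    rw [h] at this
    simp only [Pi.zero_apply, Pi.add_apply, Pi.smul_apply, smul_eq_mul] at this
    linear_combination (-f x) * this
  have h2 : 0 ≤ ∑ x, cubeDown n f x * cubeDown n f x :=
    Finset.sum_nonneg fun x _ => mul_self_nonneg _
  have h3 : 0 ≤ ∑ x, f x * f x := Finset.sum_nonneg fun x _ => mul_self_nonneg _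
  have h4 : 0 < (n : ℝ) - 2 * t := by
    have : ((2 * t : ℕ) : ℝ) < n := by exact_mod_cast ht
    push_cast at this
    linarith
  have h5 : ∑ x, f x * f x = 0 := by nlinarith
  funext x
  exact mul_self_eq_zero.1 ((Finset.sum_eq_zero_iff_of_nonneg fun x _ => mul_self_nonneg _).1 h5 x
    (Finset.mem_univ x))

/-- DU is an injective endomorphism of the finite-dimensional level t, hence surjective, so D is
already onto. Rank-nullity then gives the dimension of the harmonic space. -/
theorem map_cubeDown_cubeLevel {t : ℕ} (ht : 2 * t < n) :
    (cubeLevel n (t + 1)).map (cubeDown n) = cubeLevel n t := by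
  apply le_antisymm
  · rintro _ ⟨f, hf, rfl⟩
    exact cubeDown_mem_cubeLevel hf
  · let T : cubeLevel n t →ₗ[ℝ] cubeLevel n t :=
      (cubeDown n ∘ₗ cubeUp n).restrict fun f hf => cubeDown_mem_cubeLevel (cubeUp_mem_cubeLevel hf)
    have hT : Function.Injective T := by
      rw [injective_iff_map_eq_zero]
      intro f hf
      exact Subtype.ext (cubeDown_cubeUp_eq_zero ht f.2 (congrArg Subtype.val hf))
    intro g hg
    obtain ⟨f, hf⟩ := LinearMap.surjective_of_injective hT ⟨g, hg⟩
    exact ⟨cubeUp n f, cubeUp_mem_cubeLevel f.2, congrArg Subtype.val hf⟩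

theorem finrank_cubeHarmonic {t : ℕ} (ht : 2 * t ≤ n) :
    (Module.finrank ℝ (cubeHarmonic n t) : ℤ) = binomDiff n t := by
  cases t with
  | zero =>
    rw [cubeHarmonic, inf_eq_left.2 cubeLevel_zero_le_ker, finrank_cubeLevel, binomDiff]
  | succ t =>
    have h := LinearMap.finrank_range_add_finrank_ker
      ((cubeDown n).domRestrict (cubeLevel n (t + 1)))
    rw [LinearMap.range_domRestrict, map_cubeDown_cubeLevel (by omega), finrank_cubeLevel,
      finrank_cubeLevel, LinearMap.ker_domRestrict,
      ← Submodule.finrank_map_subtype_eq, Submodule.map_comap_subtype] at h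
    rw [binomDiff, cubeHarmonic, ← h]
    push_cast
    ring

theorem binomDiff_pos {t : ℕ} (ht : 2 * t ≤ n) : 0 < binomDiff n t := by
  cases t with
  | zero => simp [binomDiff]
  | succ t =>
    have h := Nat.choose_succ_right_eq n t
    have h0 : 0 < n.choose t := Nat.choose_pos (by omega)
    have : n.choose t < n.choose (t + 1) := by
      by_contra! hle
      have h1 : n.choose t * (t + 1) < n.choose t * (n - t) :=
        Nat.mul_lt_mul_of_pos_left (by omega) h0
      have h2 := Nat.mul_le_mul_right (t + 1) hle
      omega
    rw [binomDiff]
    omega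

end Cube

/-! ### The orthogonal polynomials of the tridiagonal matrix and their roots. -/

open Polynomial in
/-- The monic rescaling of the Krawtchouk polynomials in the variable `2x - m`. -/
noncomputable def krawtchoukMonic (m : ℝ) : ℕ → ℝ[X]
  | 0 => 1
  | 1 => X
  | k + 2 => X * krawtchoukMonic m (k + 1) - C ((k + 1 : ℝ) * (m - k)) * krawtchoukMonic m k

section KrawtchoukMonic

open Polynomial

variable (m : ℝ)

theorem krawtchoukMonic_add_two (k : ℕ) :
    krawtchoukMonic m (k + 2) =
      X * krawtchoukMonic m (k + 1) - C ((k + 1 : ℝ) * (m - k)) * krawtchoukMonic m k := rfl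

theorem krawtchoukMonic_monic_natDegree (k : ℕ) :
    ((krawtchoukMonic m k).Monic ∧ (krawtchoukMonic m k).natDegree = k) ∧
      ((krawtchoukMonic m (k + 1)).Monic ∧ (krawtchoukMonic m (k + 1)).natDegree = k + 1) := by
  induction k with
  | zero => simp [krawtchoukMonic, monic_X]
  | succ k ih =>
    obtain ⟨⟨h1, h2⟩, h3, h4⟩ := ih
    refine ⟨⟨h3, h4⟩, ?_⟩
    have hX : (X * krawtchoukMonic m (k + 1)).Monic := monic_X.mul h3
    have hXd : (X * krawtchoukMonic m (k + 1)).natDegree = k + 2 := by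
      rw [monic_X.natDegree_mul h3, natDegree_X, h4]; ring
    have hlt : (C ((k + 1 : ℝ) * (m - k)) * krawtchoukMonic m k).degree <
        (X * krawtchoukMonic m (k + 1)).degree := by
      apply degree_lt_degree
      rw [hXd]
      have := natDegree_C_mul_le ((k + 1 : ℝ) * (m - k)) (krawtchoukMonic m k)
      omega
    refine ⟨hX.sub_of_left hlt, ?_⟩
    rw [krawtchoukMonic_add_two, natDegree_sub_eq_left_of_natDegree_lt _, hXd]
    have := natDegree_C_mul_le ((k + 1 : ℝ) * (m - k)) (krawtchoukMonic m k)
    omega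

/-- Confluent Christoffel–Darboux: the recurrence turns this Wronskian w_k into w_(k+1) = P_(k+1)² +
(k+1)(m-k) w_k. It rules out multiple real roots. -/
theorem krawtchoukMonic_wronskian_pos (x : ℝ) (k : ℕ) (hk : (k : ℝ) ≤ m) :
    0 < (derivative (krawtchoukMonic m (k + 1))).eval x * (krawtchoukMonic m k).eval x -
      (derivative (krawtchoukMonic m k)).eval x * (krawtchoukMonic m (k + 1)).eval x := by
  induction k with
  | zero => simp [krawtchoukMonic]
  | succ k ih =>
    push_cast at hk
    have h1 := ih (by linarith)
    have hb : 0 < (k + 1 : ℝ) * (m - k) := mul_pos (by positivity) (by linarith)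
    have h2 := mul_pos hb h1
    rw [krawtchoukMonic_add_two]
    simp only [derivative_sub, derivative_mul, derivative_X, derivative_C, eval_sub, eval_mul,
      eval_add, eval_X, eval_C, eval_one, eval_zero]
    nlinarith [sq_nonneg ((krawtchoukMonic m (k + 1)).eval x)]

/-- Christoffel–Darboux at z and its conjugate: each step adds (Im z)² |P_(k+1)(z)|² to a positive
multiple of the previous quantity. It rules out non-real roots. -/
theorem krawtchoukMonic_im_pos (z : ℂ) (hz : z.im ≠ 0) (k : ℕ) (hk : (k : ℝ) ≤ m) :
    0 < z.im * (aeval z (krawtchoukMonic m (k + 1)) *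
      (starRingEnd ℂ) (aeval z (krawtchoukMonic m k))).im := by
  induction k with
  | zero => simpa [krawtchoukMonic, sq] using sq_pos_of_ne_zero hz
  | succ k ih =>
    push_cast at hk
    have h1 := ih (by linarith)
    have hb : 0 < (k + 1 : ℝ) * (m - k) := mul_pos (by positivity) (by linarith)
    have h2 := mul_pos hb h1
    rw [krawtchoukMonic_add_two]
    generalize (k + 1 : ℝ) * (m - k) = b at *
    simp only [map_sub, map_mul, aeval_X, aeval_C, Complex.coe_algebraMap]
    generalize (aeval z) (krawtchoukMonic m (k + 1)) = p at *
    generalize (aeval z) (krawtchoukMonic m k) = q at *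
    simp only [Complex.mul_im, Complex.sub_im, Complex.sub_re, Complex.mul_re, Complex.conj_re,
      Complex.conj_im, Complex.ofReal_re, Complex.ofReal_im] at *
    nlinarith [mul_nonneg (sq_nonneg z.im) (add_nonneg (sq_nonneg p.re) (sq_nonneg p.im))]

theorem krawtchoukMonic_ncard_roots (k : ℕ) (hk : (k : ℝ) ≤ m) :
    {x : ℝ | (krawtchoukMonic m (k + 1)).eval x = 0}.ncard = k + 1 := by
  set p := krawtchoukMonic m (k + 1) with hp
  obtain ⟨hm, hd⟩ := (krawtchoukMonic_monic_natDegree m k).2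
  have hreal : ∀ z : ℂ, aeval z p = 0 → z.im = 0 := by
    intro z hz
    by_contra h
    have := krawtchoukMonic_im_pos m z h k hk
    rw [← hp, hz] at this
    simp at this
  have hq0 : p.map (algebraMap ℝ ℂ) ≠ 0 := (hm.map _).ne_zero
  have hnodup : (p.map (algebraMap ℝ ℂ)).roots.Nodup := by
    rw [Multiset.nodup_iff_count_le_one]
    intro z
    rw [count_roots]
    by_contra! h
    obtain ⟨h1, h2⟩ := (one_lt_rootMultiplicity_iff_isRoot hq0).1 h
    have hz : aeval z p = 0 := by rwa [IsRoot.def, eval_map_algebraMap] at h1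
    have hz' : z = ((z.re : ℝ) : ℂ) := by
      apply Complex.ext <;> simp [hreal z hz]
    rw [derivative_map, IsRoot.def, eval_map_algebraMap, hz'] at h2
    rw [hz'] at hz
    have e (q : ℝ[X]) (x : ℝ) : aeval (x : ℂ) q = ((q.eval x : ℝ) : ℂ) := by
      simpa using aeval_algebraMap_apply ℂ x q
    rw [e] at h2 hz
    have := krawtchoukMonic_wronskian_pos m z.re k hk
    rw [← hp, Complex.ofReal_eq_zero.1 h2, Complex.ofReal_eq_zero.1 hz] at this
    simp at this
  -- Over ℂ the number of roots with multiplicity is the degree; the roots are simple, and `hreal`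
  -- brings them back to ℝ.
  have hcard : (p.map (algebraMap ℝ ℂ)).roots.toFinset.card = k + 1 := by
    rw [Multiset.toFinset_card_of_nodup hnodup, IsAlgClosed.card_roots_eq_natDegree, hm.natDegree_map,
      hd]
  have himg : ((fun x : ℝ => (x : ℂ)) '' {x : ℝ | p.eval x = 0}) =
      ((p.map (algebraMap ℝ ℂ)).roots.toFinset : Set ℂ) := by
    ext z
    simp only [Set.mem_image, Set.mem_ofPred_eq, Finset.mem_coe, Multiset.mem_toFinset,
      mem_roots hq0, IsRoot.def, eval_map_algebraMap]
    have e (q : ℝ[X]) (x : ℝ) : aeval (x : ℂ) q = ((q.eval x : ℝ) : ℂ) := by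
      simpa using aeval_algebraMap_apply ℂ x q
    constructor
    · rintro ⟨x, hx, rfl⟩
      rw [e, hx]; simp
    · intro hz
      have hz' : z = ((z.re : ℝ) : ℂ) := by
        apply Complex.ext <;> simp [hreal z hz]
      refine ⟨z.re, ?_, hz'.symm⟩
      rw [hz', e] at hz
      exact_mod_cast hz
  rw [← Set.ncard_image_of_injective _ Complex.ofReal_injective, himg, Set.ncard_coe_finset, hcard]

end KrawtchoukMonic

/-! ### Krawtchouk polynomials: generating function and three-term recurrence. -/

section Krawtchouk

open Polynomial

theorem binomPoly_eval_succ (x : ℝ) (l : ℕ) :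
    ((l : ℝ) + 1) * (binomPoly (l + 1)).eval x = (x - l) * (binomPoly l).eval x := by
  simp only [binomPoly, eval_mul, eval_C, descPochhammer_succ_eval, Nat.factorial_succ]
  have : (l.factorial : ℝ) ≠ 0 := by positivity
  push_cast
  field_simp

/-- The power series `(1 + c z) ^ x`. -/
noncomputable def binomPowerSeries (c x : ℝ) : PowerSeries ℝ :=
  PowerSeries.mk fun l => c ^ l * (binomPoly l).eval x

open PowerSeries in
theorem binomPowerSeries_derivative (c x : ℝ) :
    (1 + PowerSeries.C c * PowerSeries.X) * (d⁄dX ℝ (binomPowerSeries c x)) =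
      PowerSeries.C (c * x) * binomPowerSeries c x := by
  ext l
  rw [add_mul, one_mul, mul_assoc, map_add, PowerSeries.coeff_C_mul, PowerSeries.coeff_C_mul]
  cases l with
  | zero =>
    have := binomPoly_eval_succ x 0
    simp [binomPowerSeries, PowerSeries.coeff_derivative] at this ⊢
    rw [this]; ring
  | succ l =>
    have := binomPoly_eval_succ x (l + 1)
    simp only [binomPowerSeries, PowerSeries.coeff_derivative, PowerSeries.coeff_succ_X_mul,
      PowerSeries.coeff_mk]
    push_cast at this ⊢
    rw [pow_succ c (l + 1)]
    linear_combination (c ^ (l + 1) * c) * this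

theorem krawtchouk_eval (m k : ℕ) (x : ℝ) :
    (krawtchouk m k).eval x =
      PowerSeries.coeff k (binomPowerSeries (-1) x * binomPowerSeries 1 (m - x)) := by
  rw [PowerSeries.coeff_mul, Finset.Nat.sum_antidiagonal_eq_sum_range_succ_mk, krawtchouk,
    eval_finsetSum]
  refine Finset.sum_congr rfl fun l _ => ?_
  simp [binomPowerSeries, eval_mul, eval_comp]

open PowerSeries in
-- The generating function G = (1 - z)^x (1 + z)^(m - x) satisfies (1 - z²) G' = (m - 2x - mz) G;
-- compare coefficients of z^(k+1).
theorem krawtchouk_eval_add_two (m k : ℕ) (x : ℝ) :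
    ((k : ℝ) + 2) * (krawtchouk m (k + 2)).eval x =
      (m - 2 * x) * (krawtchouk m (k + 1)).eval x - (m - k) * (krawtchouk m k).eval x := by
  simp only [krawtchouk_eval]
  have hA := binomPowerSeries_derivative (-1) x
  have hB := binomPowerSeries_derivative 1 (m - x)
  set A := binomPowerSeries (-1) x
  set B := binomPowerSeries 1 (m - x)
  have hG : d⁄dX ℝ (A * B) - PowerSeries.X * (PowerSeries.X * d⁄dX ℝ (A * B)) =
      PowerSeries.C ((m : ℝ) - 2 * x) * (A * B) - PowerSeries.C (m : ℝ) * (PowerSeries.X * (A * B)) := by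
    rw [Derivation.leibniz]
    simp only [smul_eq_mul, map_mul, map_sub, map_neg, map_one, one_mul, neg_mul, map_ofNat] at hA hB ⊢
    linear_combination (1 + PowerSeries.X) * B * hA + (1 - PowerSeries.X) * A * hB
  have := congrArg (PowerSeries.coeff (k + 1)) hG
  rw [map_sub, map_sub, PowerSeries.coeff_C_mul, PowerSeries.coeff_C_mul,
    PowerSeries.coeff_succ_X_mul, PowerSeries.coeff_succ_X_mul,
    PowerSeries.coeff_derivative] at this
  -- The term z² G' contributes nothing when k = 0.
  cases k with
  | zero =>
    simp only [PowerSeries.coeff_zero_X_mul] at this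
    push_cast at this ⊢
    linear_combination this
  | succ k =>
    rw [PowerSeries.coeff_succ_X_mul, PowerSeries.coeff_derivative] at this
    push_cast at this ⊢
    linear_combination this

theorem krawtchoukMonic_eval (m k : ℕ) (x : ℝ) :
    (krawtchoukMonic m k).eval (2 * x - m) = (-1) ^ k * k.factorial * (krawtchouk m k).eval x := by
  induction k using Nat.twoStepInduction with
  | zero => simp [krawtchoukMonic, krawtchouk, binomPoly]
  | one => 
    simp [krawtchoukMonic, krawtchouk, binomPoly, Finset.sum_range_succ]
    ring
  | more k h1 h2 =>
    rw [krawtchoukMonic_add_two]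
    simp only [eval_sub, eval_mul, eval_X, eval_C, h1, h2, Nat.factorial_succ]
    have := krawtchouk_eval_add_two m k x
    push_cast
    linear_combination (-(-1) ^ k * (k + 1) * (k.factorial : ℝ)) * this

theorem ballLambda_eq {n r t : ℕ} (ht : t ≤ r) (hr : 2 * r ≤ n) :
    ballLambda n r t =
      {y | (krawtchoukMonic ((n - 2 * t : ℕ) : ℝ) (r - t + 1)).eval y = 0} := by
  have hc : ((n - 2 * t : ℕ) : ℝ) = (n : ℝ) - 2 * t := by
    rw [Nat.cast_sub (by omega)]; push_cast; ring
  have key (x : ℝ) : (krawtchoukMonic ((n - 2 * t : ℕ) : ℝ) (r - t + 1)).eval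
      (2 * x - ((n : ℝ) - 2 * t)) = 0 ↔ x ∈ krawtchoukRoots (n - 2 * t) (r - t + 1) := by
    rw [← hc, krawtchoukMonic_eval]
    simp [krawtchoukRoots, Nat.factorial_ne_zero]
  ext y
  constructor
  · rintro ⟨x, hx, rfl⟩
    exact (key x).2 hx
  · intro hy
    refine ⟨(y + ((n : ℝ) - 2 * t)) / 2, ?_, by ring⟩
    rw [← key]
    have e : 2 * ((y + ((n : ℝ) - 2 * t)) / 2) - ((n : ℝ) - 2 * t) = y := by ring
    rw [e]
    exact hy

theorem ballLambda_ncard {n r t : ℕ} (ht : t ≤ r) (hr : 2 * r ≤ n) :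
    (ballLambda n r t).ncard = r - t + 1 := by
  rw [ballLambda_eq ht hr]
  -- Here r + t ≤ 2r ≤ n keeps the recurrence coefficients positive.
  exact krawtchoukMonic_ncard_roots _ _ (by exact_mod_cast (by omega : r - t ≤ n - 2 * t))

end Krawtchouk

/-! ### Harmonic functions and the Johnson scheme. -/

section BallEigenspace

variable {n : ℕ}

/-- The indicator of `{x ∈ S(n,i) : z ⊆ x}`, as a function on the cube. -/
def supersetFun (i : ℕ) (z : HCube n) : HCube n → ℝ :=
  fun x => if hWeight x = i ∧ ∀ k, z k = true → x k = true then 1 else 0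

theorem cubeToSphere_supersetFun (i : ℕ) (z : HCube n) :
    cubeToSphere n i (supersetFun i z) = gFun n i z := by
  funext x
  have hx : hWeight x.1 = i := x.2
  simp [cubeToSphere, LinearMap.funLeft_apply, supersetFun, gFun, hx]

/-- For x ⊇ z of weight i + 1, the lower neighbours still containing z arise by deleting one of the
i + 1 - |z| elements of x outside z. So U preserves the filtration by the spaces U_j. -/
theorem cubeUp_supersetFun (i : ℕ) (z : HCube n) :
    cubeUp n (supersetFun i z) = ((i : ℝ) + 1 - hWeight z) • supersetFun (i + 1) z := by
  funext x
  rw [cubeUp_apply, Pi.smul_apply, smul_eq_mul]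
  by_cases hx : hWeight x = i + 1
  · by_cases hz : ∀ k, z k = true → x k = true
    · have h1 : supersetFun (i + 1) z x = 1 := if_pos ⟨hx, hz⟩
      have h2 : (i : ℝ) + 1 = hWeight x := by rw [hx]; push_cast; ring
      rw [h1, h2, mul_one, hWeight_eq_sum, hWeight_eq_sum, ← Finset.sum_sub_distrib]
      refine Finset.sum_congr rfl fun k _ => ?_
      cases hk : x k
      · have : z k = false := by
          by_contra h
          simp [hz k (by simpa using h)] at hk
        simp [this]
      · have hw : hWeight (cubeFlip k x) = i := by
          have := hWeight_cubeFlip_of_true hk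
          omega
        cases hzk : z k
        · have : ∀ l, z l = true → cubeFlip k x l = true := by
            intro l hl
            have : l ≠ k := by rintro rfl; simp [hzk] at hl
            rw [cubeFlip_of_ne this]
            exact hz l hl
          simp only [supersetFun, hw, true_and, if_pos this]
          simp
        · have : ¬ ∀ l, z l = true → cubeFlip k x l = true := by
            intro h
            have := h k hzk
            simp [hk] at this
          simp [supersetFun, this]
    · have h1 : supersetFun (i + 1) z x = 0 := if_neg fun h => hz h.2
      rw [h1, mul_zero]
      refine Finset.sum_eq_zero fun k _ => ?_
      split_ifs with hk
      · refine if_neg fun h => hz fun l hl => ?_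
        by_cases hlk : l = k
        · rw [hlk, hk]
        · rw [← cubeFlip_of_ne hlk x]
          exact h.2 l hl
      · rfl
  · have h1 : supersetFun (i + 1) z x = 0 := if_neg fun h => hx h.1
    rw [h1, mul_zero]
    refine Finset.sum_eq_zero fun k _ => ?_
    split_ifs with hk
    · refine if_neg fun h => hx ?_
      rw [← hWeight_cubeFlip_of_true hk, h.1]
    · rfl

theorem supersetFun_hWeight (z : HCube n) : supersetFun (hWeight z) z = Pi.single z 1 := by
  funext x
  by_cases hx : x = z
  · subst hx
    simp [supersetFun]
  · rw [Pi.single_eq_of_ne hx]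
    refine if_neg fun h => hx ?_
    have hsub : {k | z k = true} ⊆ {k | x k = true} := fun k hk => h.2 k hk
    have hcard := h.1
    rw [hWeight_eq_card, hWeight_eq_card] at hcard
    have := Set.eq_of_subset_of_ncard_le hsub hcard.le
    funext k
    have hk : z k = true ↔ x k = true := Set.ext_iff.1 this k
    exact (Bool.eq_iff_iff.2 hk).symm

theorem mem_span_supersetFun {t : ℕ} {h : HCube n → ℝ} (hh : h ∈ cubeLevel n t) :
    h ∈ Submodule.span ℝ (supersetFun t '' {z : HCube n | hWeight z ≤ t}) := by
  have e : h = ∑ z, h z • Pi.single z (1 : ℝ) := by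
    simp [← Pi.single_smul, Finset.univ_sum_single]
  rw [e]
  refine Submodule.sum_mem _ fun z _ => ?_
  by_cases hz : hWeight z = t
  · refine Submodule.smul_mem _ _ (Submodule.subset_span ⟨z, hz.le, ?_⟩)
    rw [← hz, supersetFun_hWeight]
  · rw [hh z hz, zero_smul]
    exact Submodule.zero_mem _

theorem cubeUp_mem_span_supersetFun {i j : ℕ} {f : HCube n → ℝ}
    (hf : f ∈ Submodule.span ℝ (supersetFun i '' {z : HCube n | hWeight z ≤ j})) :
    cubeUp n f ∈ Submodule.span ℝ (supersetFun (i + 1) '' {z : HCube n | hWeight z ≤ j}) := by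
  induction hf using Submodule.span_induction with
  | mem f hf =>
    obtain ⟨z, hz, rfl⟩ := hf
    rw [cubeUp_supersetFun]
    exact Submodule.smul_mem _ _ (Submodule.subset_span ⟨z, hz, rfl⟩)
  | zero => simp
  | add f g _ _ hf hg => rw [map_add]; exact Submodule.add_mem _ hf hg
  | smul c f _ hf => rw [map_smul]; exact Submodule.smul_mem _ _ hf

theorem pow_cubeUp_mem_span_supersetFun {t : ℕ} {h : HCube n → ℝ} (hh : h ∈ cubeLevel n t) (j : ℕ) :
    (cubeUp n ^ j) h ∈
      Submodule.span ℝ (supersetFun (t + j) '' {z : HCube n | hWeight z ≤ t}) := by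
  induction j with
  | zero => exact mem_span_supersetFun hh
  | succ j ih =>
    rw [pow_succ', Module.End.mul_apply]
    exact cubeUp_mem_span_supersetFun ih

theorem cubeToSphere_mem_johnsonU {i j : ℕ} {f : HCube n → ℝ}
    (hf : f ∈ Submodule.span ℝ (supersetFun i '' {z : HCube n | hWeight z ≤ j})) :
    cubeToSphere n i f ∈ johnsonU n i j := by
  have := Submodule.mem_map_of_mem (f := cubeToSphere n i) hf
  rw [Submodule.map_span, Set.image_image] at this
  simp only [cubeToSphere_supersetFun] at this
  exact this

/-- Up to a nonzero factor the indicator is U of the one a level below. Moving U across as D lowers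
the power of U acting on h, until Dh = 0 is reached. -/
theorem sum_mul_supersetFun_eq_zero {t : ℕ} {h : HCube n → ℝ} (hh : h ∈ cubeHarmonic n t)
    {w : HCube n} (hw : hWeight w < t) (j : ℕ) :
    ∑ x, (cubeUp n ^ j) h x * supersetFun (t + j) w x = 0 := by
  have key (i : ℕ) (hi : hWeight w ≤ i) (f : HCube n → ℝ)
      (hf : ∑ x, cubeDown n f x * supersetFun i w x = 0) :
      ∑ x, f x * supersetFun (i + 1) w x = 0 := by
    have hne : (i : ℝ) + 1 - hWeight w ≠ 0 := by
      have : (hWeight w : ℝ) ≤ i := by exact_mod_cast hi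
      intro h
      linarith
    have e := sum_cubeUp_mul (supersetFun i w) f
    rw [cubeUp_supersetFun] at e
    simp only [Pi.smul_apply, smul_eq_mul, mul_assoc, ← Finset.mul_sum] at e
    simp only [mul_comm (cubeDown n f _)] at hf
    rw [hf] at e
    simpa only [mul_comm (f _)] using (mul_eq_zero.1 e).resolve_left hne
  induction j with
  | zero =>
    obtain ⟨s, rfl⟩ : ∃ s, t = s + 1 := ⟨t - 1, by omega⟩
    refine key s (by omega) _ ?_
    have h0 : cubeDown n h = 0 := hh.2
    simp [h0]
  | succ j ih =>
    refine key (t + j) (by omega) _ ?_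
    rw [cubeDown_pow_cubeUp hh]
    simp only [Pi.smul_apply, smul_eq_mul, mul_assoc, ← Finset.mul_sum, ih, mul_zero]

theorem sum_hSphere_mul {i : ℕ} {g : HCube n → ℝ} (hg : g ∈ cubeLevel n i) (f : HCube n → ℝ) :
    ∑ x : hSphere n i, f x.1 * g x.1 = ∑ x, f x * g x := by
  rw [← Finset.sum_subtype (Finset.univ.filter (· ∈ hSphere n i)) (by simp) fun x => f x * g x]
  refine Finset.sum_subset (Finset.filter_subset _ _) fun x _ hx => ?_
  rw [hg x fun h => hx (Finset.mem_filter.2 ⟨Finset.mem_univ x, h⟩), mul_zero]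

theorem supersetFun_mem (i : ℕ) (z : HCube n) : supersetFun i z ∈ cubeLevel n i :=
  fun _ hx => if_neg fun h => hx h.1

theorem mem_orthCompl_johnsonU {i j : ℕ} (f : HCube n → ℝ) :
    cubeToSphere n i f ∈ orthCompl (johnsonU n i j) ↔
      ∀ w : HCube n, hWeight w ≤ j → ∑ x, f x * supersetFun i w x = 0 := by
  have e (w : HCube n) : ∑ x, cubeToSphere n i f x * gFun n i w x =
      ∑ x, f x * supersetFun i w x := by
    rw [← sum_hSphere_mul (supersetFun_mem i w), ← cubeToSphere_supersetFun]
    rfl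
  constructor
  · intro h w hw
    rw [← e]
    exact h _ (Submodule.subset_span ⟨w, hw, rfl⟩)
  · intro h g hg
    induction hg using Submodule.span_induction with
    | mem g hg =>
      obtain ⟨w, hw, rfl⟩ := hg
      rw [e]
      exact h w hw
    | zero => simp
    | add a b _ _ ha hb =>
      simp only [Pi.add_apply, mul_add, Finset.sum_add_distrib, ha, hb, add_zero]
    | smul c a _ ha =>
      simp only [Pi.smul_apply, smul_eq_mul, mul_left_comm _ c, ← Finset.mul_sum, ha, mul_zero]

theorem cubeToSphere_pow_cubeUp_mem_johnsonV {t : ℕ} {h : HCube n → ℝ}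
    (hh : h ∈ cubeHarmonic n t) (j : ℕ) :
    cubeToSphere n (t + j) ((cubeUp n ^ j) h) ∈ johnsonV n (t + j) t := by
  have hU := cubeToSphere_mem_johnsonU (pow_cubeUp_mem_span_supersetFun hh.1 j)
  cases t with
  | zero => exact hU
  | succ t =>
    refine ⟨hU, (mem_orthCompl_johnsonU _).2 fun w hw => ?_⟩
    exact sum_mul_supersetFun_eq_zero hh (by omega) j

theorem map_cubeToSphere_cubeHarmonic (n t : ℕ) :
    (cubeHarmonic n t).map (cubeToSphere n t) = johnsonV n t t := by
  apply le_antisymm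
  · rintro _ ⟨h, hh, rfl⟩
    exact cubeToSphere_pow_cubeUp_mem_johnsonV hh 0
  · intro f hf
    refine ⟨sphereExtend f, ⟨sphereExtend_mem f, ?_⟩, cubeToSphere_sphereExtend f⟩
    cases t with
    | zero => exact cubeLevel_zero_le_ker (sphereExtend_mem f)
    | succ t =>
      have horth : cubeToSphere n (t + 1) (sphereExtend f) ∈ orthCompl (johnsonU n (t + 1) t) := by
        rw [cubeToSphere_sphereExtend]
        exact hf.2
      refine LinearMap.mem_ker.2 (funext fun w => ?_)
      -- On level t the point mass at w is a superset indicator, so (Df)(w) is the pairing of f with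
      -- a generator of U_t on S(n,t+1), to which f is orthogonal.
      by_cases hw : hWeight w = t
      · subst hw
        have h1 := (mem_orthCompl_johnsonU _).1 horth w le_rfl
        have h2 := sum_cubeUp_mul (supersetFun (hWeight w) w) (sphereExtend f)
        rw [cubeUp_supersetFun, supersetFun_hWeight] at h2
        simp only [mul_comm (sphereExtend f _)] at h1
        simp [h1, Pi.single_apply] at h2
        exact h2.symm
      · exact cubeDown_mem_cubeLevel (sphereExtend_mem f) w hw

/-! ### Eigenfunctions on the ball. -/

/-- Restriction of functions from the cube to the ball `B(n,r)`. -/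
def cubeToBall (n r : ℕ) : (HCube n → ℝ) →ₗ[ℝ] (hBall n r → ℝ) :=
  LinearMap.funLeft ℝ ℝ Subtype.val

theorem hBallOp_cubeToBall {r : ℕ} {f : HCube n → ℝ} (hf : ∀ x, r < hWeight x → f x = 0) :
    hBallOp n r (cubeToBall n r f) = cubeToBall n r (cubeUp n f + cubeDown n f) := by
  funext x
  have h1 : hBallOp n r (cubeToBall n r f) x =
      ∑ y : hBall n r, if hammingDist x.1 y.1 = 1 then f y.1 else 0 := by
    simp only [hBallOp, Matrix.toLin'_apply, Matrix.mulVec, dotProduct, hBallAdj,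
      SimpleGraph.adjMatrix_apply, cubeToBall, LinearMap.funLeft_apply, ite_mul, one_mul, zero_mul]
    rfl
  have h2 : cubeToBall n r (cubeUp n f + cubeDown n f) x = ∑ k, f (cubeFlip k x.1) :=
    cubeUp_add_cubeDown_apply f x.1
  have h3 : ∑ y : hBall n r, (if hammingDist x.1 y.1 = 1 then f y.1 else 0) =
      ∑ y, if hammingDist x.1 y = 1 then f y else 0 := by
    rw [← Finset.sum_subtype (Finset.univ.filter (· ∈ hBall n r)) (by simp)
      fun y => if hammingDist x.1 y = 1 then f y else 0]
    refine Finset.sum_subset (Finset.filter_subset _ _) fun y _ hy => ?_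
    rw [hf y (not_le.1 fun h => hy (Finset.mem_filter.2 ⟨Finset.mem_univ y, h⟩)), ite_self]
  rw [h1, h2, h3, ← Finset.sum_filter, ← Finset.sum_image (f := f) (g := fun k => cubeFlip k x.1)
    (fun a _ b _ h => cubeFlip_injective_left x.1 h)]
  congr 1
  ext y
  simp only [Finset.mem_filter_univ, Finset.mem_image, Finset.mem_univ, true_and,
    hammingDist_eq_one_iff, eq_comm (b := y)]

/-- The coefficients of an eigenfunction in terms of iterated raisings of a harmonic function. -/
noncomputable def ballCoeff (m μ : ℝ) (i : ℕ) : ℝ :=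
  (krawtchoukMonic m i).eval μ / ∏ j ∈ Finset.range i, (((j : ℝ) + 1) * (m - j))

theorem ballCoeff_succ_mul {m μ : ℝ} {i : ℕ} (hi : (i : ℝ) < m) :
    ballCoeff m μ (i + 1) * (((i : ℝ) + 1) * (m - i)) =
      (krawtchoukMonic m (i + 1)).eval μ / ∏ j ∈ Finset.range i, (((j : ℝ) + 1) * (m - j)) := by
  have h1 : ((i : ℝ) + 1) * (m - i) ≠ 0 := (mul_pos (by positivity) (by linarith)).ne'
  rw [ballCoeff, Finset.prod_range_succ, ← div_div, div_mul_cancel₀ _ h1]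

theorem ballCoeff_recurrence {m μ : ℝ} {i : ℕ} (hi : (i : ℝ) < m) :
    (krawtchoukMonic m (i + 2)).eval μ / ∏ j ∈ Finset.range (i + 1), (((j : ℝ) + 1) * (m - j)) =
      μ * ballCoeff m μ (i + 1) - ballCoeff m μ i := by
  have h1 : ((i : ℝ) + 1) * (m - i) ≠ 0 := (mul_pos (by positivity) (by linarith)).ne'
  rw [ballCoeff, ballCoeff, krawtchoukMonic_add_two, Finset.prod_range_succ]
  simp only [Polynomial.eval_sub, Polynomial.eval_mul, Polynomial.eval_X, Polynomial.eval_C]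
  rw [sub_div, mul_div_assoc, mul_comm (∏ j ∈ _, _) (_ * _), mul_div_mul_left _ _ h1]

/-- The coefficients solve the eigenvalue equation level by level, leaving two boundary terms. For N
= r - t, one lies on level r + 1, outside the ball, and the other vanishes at a root μ of P_(r-t+1).
-/
theorem cubeUp_add_cubeDown_sum {t : ℕ} {h : HCube n → ℝ} (hh : h ∈ cubeHarmonic n t) (μ : ℝ)
    (N : ℕ) (hN : (N : ℝ) ≤ (n : ℝ) - 2 * t) :
    (cubeUp n + cubeDown n) (∑ i ∈ Finset.range (N + 1),
        ballCoeff ((n : ℝ) - 2 * t) μ i • (cubeUp n ^ i) h) =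
      μ • ∑ i ∈ Finset.range (N + 1), ballCoeff ((n : ℝ) - 2 * t) μ i • (cubeUp n ^ i) h +
        ballCoeff ((n : ℝ) - 2 * t) μ N • (cubeUp n ^ (N + 1)) h -
        ((krawtchoukMonic ((n : ℝ) - 2 * t) (N + 1)).eval μ /
          ∏ j ∈ Finset.range N, (((j : ℝ) + 1) * ((n : ℝ) - 2 * t - j))) • (cubeUp n ^ N) h := by
  induction N with
  | zero =>
    have h0 : cubeDown n h = 0 := hh.2
    simp [ballCoeff, krawtchoukMonic, h0]
  | succ N ih =>
    push_cast at hN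
    have hlt : (N : ℝ) < (n : ℝ) - 2 * t := by linarith
    rw [Finset.sum_range_succ, map_add, ih hlt.le, ← ballCoeff_succ_mul hlt,
      ballCoeff_recurrence hlt, map_smul, LinearMap.add_apply, cubeDown_pow_cubeUp hh,
      ← Module.End.mul_apply, ← pow_succ']
    module

/-- The function on the cube built from a harmonic function on `S(n,t)`. -/
noncomputable def ballLift (n r t : ℕ) (μ : ℝ) : Module.End ℝ (HCube n → ℝ) :=
  ∑ i ∈ Finset.range (r - t + 1), ballCoeff ((n : ℝ) - 2 * t) μ i • cubeUp n ^ i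

theorem ballLift_apply (r t : ℕ) (μ : ℝ) (h : HCube n → ℝ) :
    ballLift n r t μ h = ∑ i ∈ Finset.range (r - t + 1),
      ballCoeff ((n : ℝ) - 2 * t) μ i • (cubeUp n ^ i) h := by
  simp [ballLift, LinearMap.sum_apply]

/-- The space `W_t(μ)` of eigenfunctions. -/
noncomputable def ballW (n r t : ℕ) (μ : ℝ) : Submodule ℝ (hBall n r → ℝ) :=
  (cubeHarmonic n t).map (cubeToBall n r ∘ₗ ballLift n r t μ)

theorem ballLift_apply_of_lt {r t : ℕ} (μ : ℝ) {h : HCube n → ℝ} (hh : h ∈ cubeHarmonic n t)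
    {x : HCube n} (hx : hWeight x < t) : ballLift n r t μ h x = 0 := by
  rw [ballLift_apply, Finset.sum_apply]
  refine Finset.sum_eq_zero fun i _ => ?_
  rw [Pi.smul_apply, pow_cubeUp_mem_cubeLevel hh.1 i x (by omega), smul_zero]

theorem ballLift_apply_of_add {r t : ℕ} (μ : ℝ) {h : HCube n → ℝ} (hh : h ∈ cubeHarmonic n t)
    {x : HCube n} {j : ℕ} (hx : hWeight x = t + j) (hj : t + j ≤ r) :
    ballLift n r t μ h x = ballCoeff ((n : ℝ) - 2 * t) μ j * (cubeUp n ^ j) h x := by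
  rw [ballLift_apply, Finset.sum_apply, Finset.sum_eq_single j]
  · rfl
  · intro i _ hi
    rw [Pi.smul_apply, pow_cubeUp_mem_cubeLevel hh.1 i x (by omega), smul_zero]
  · intro hj'
    rw [Finset.mem_range] at hj'
    omega

theorem ballLift_apply_of_gt {r t : ℕ} (ht : t ≤ r) (μ : ℝ) {h : HCube n → ℝ}
    (hh : h ∈ cubeHarmonic n t) {x : HCube n} (hx : r < hWeight x) : ballLift n r t μ h x = 0 := by
  rw [ballLift_apply, Finset.sum_apply]
  refine Finset.sum_eq_zero fun i hi => ?_
  rw [Finset.mem_range] at hi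
  rw [Pi.smul_apply, pow_cubeUp_mem_cubeLevel hh.1 i x (by omega), smul_zero]

theorem ballW_le_eigenspace {r t : ℕ} (hr : 2 * r ≤ n) (ht : t ≤ r) {μ : ℝ}
    (hμ : μ ∈ ballLambda n r t) : ballW n r t μ ≤ Module.End.eigenspace (hBallOp n r) μ := by
  rintro _ ⟨h, hh, rfl⟩
  rw [Module.End.mem_eigenspace_iff, LinearMap.comp_apply,
    hBallOp_cubeToBall fun x hx => ballLift_apply_of_gt ht μ hh hx, ← map_smul]
  have hc : ((n - 2 * t : ℕ) : ℝ) = (n : ℝ) - 2 * t := by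
    rw [Nat.cast_sub (by omega)]; push_cast; ring
  have hN : ((r - t : ℕ) : ℝ) ≤ (n : ℝ) - 2 * t := by
    rw [← hc]
    exact_mod_cast (by omega : r - t ≤ n - 2 * t)
  rw [ballLambda_eq ht hr, hc] at hμ
  have hroot : (krawtchoukMonic ((n : ℝ) - 2 * t) (r - t + 1)).eval μ = 0 := hμ
  have := cubeUp_add_cubeDown_sum hh μ (r - t) hN
  rw [hroot, zero_div, zero_smul, sub_zero, ← ballLift_apply, LinearMap.add_apply] at this
  rw [this]
  funext x
  have hx : hWeight x.1 ≤ r := x.2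
  have h0 : (cubeUp n ^ (r - t + 1)) h x.1 = 0 :=
    pow_cubeUp_mem_cubeLevel hh.1 _ _ (by omega)
  simp [cubeToBall, LinearMap.funLeft_apply, h0]

theorem restrictSphere_ballLift {r t j : ℕ} (hj : t + j ≤ r) (μ : ℝ) {h : HCube n → ℝ}
    (hh : h ∈ cubeHarmonic n t) :
    restrictSphere n hj (cubeToBall n r (ballLift n r t μ h)) =
      ballCoeff ((n : ℝ) - 2 * t) μ j • cubeToSphere n (t + j) ((cubeUp n ^ j) h) := by
  funext x
  exact ballLift_apply_of_add μ hh x.2 hj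

theorem restrictSphere_ballLift_self {r t : ℕ} (ht : t ≤ r) (μ : ℝ) {h : HCube n → ℝ}
    (hh : h ∈ cubeHarmonic n t) :
    restrictSphere n ht (cubeToBall n r (ballLift n r t μ h)) = cubeToSphere n t h := by
  have := restrictSphere_ballLift (j := 0) ht μ hh
  rw [this]
  simp [ballCoeff, krawtchoukMonic]

theorem ballW_apply_of_lt {r t : ℕ} {μ : ℝ} {f : hBall n r → ℝ} (hf : f ∈ ballW n r t μ)
    (x : hBall n r) (hx : hWeight x.1 < t) : f x = 0 := by
  obtain ⟨h, hh, rfl⟩ := hf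
  exact ballLift_apply_of_lt μ hh hx

theorem restrictSphere_mem_johnsonV {r t : ℕ} {μ : ℝ} {f : hBall n r → ℝ}
    (hf : f ∈ ballW n r t μ) {i : ℕ} (hi : i ≤ r) (hti : t ≤ i) :
    restrictSphere n hi f ∈ johnsonV n i t := by
  obtain ⟨h, hh, rfl⟩ := hf
  obtain ⟨j, rfl⟩ := Nat.exists_eq_add_of_le hti
  rw [LinearMap.comp_apply, restrictSphere_ballLift hi μ hh]
  exact Submodule.smul_mem _ _ (cubeToSphere_pow_cubeUp_mem_johnsonV hh j)

theorem map_restrictSphere_ballW {r t : ℕ} (ht : t ≤ r) (μ : ℝ) :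
    (ballW n r t μ).map (restrictSphere n ht) = johnsonV n t t := by
  rw [← map_cubeToSphere_cubeHarmonic, ballW, ← Submodule.map_comp]
  ext f
  constructor
  · rintro ⟨h, hh, rfl⟩
    exact ⟨h, hh, (restrictSphere_ballLift_self ht μ hh).symm⟩
  · rintro ⟨h, hh, rfl⟩
    exact ⟨h, hh, restrictSphere_ballLift_self ht μ hh⟩

/-- The coefficient of U^0 h is 1, so the restriction to S(n,t) recovers h. -/
theorem injOn_restrictSphere_ballW {r t : ℕ} (ht : t ≤ r) (μ : ℝ) :
    Set.InjOn (restrictSphere n ht) (ballW n r t μ : Set (hBall n r → ℝ)) := by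
  rintro _ ⟨h, hh, rfl⟩ _ ⟨g, hg, rfl⟩ e
  rw [LinearMap.comp_apply, LinearMap.comp_apply, restrictSphere_ballLift_self ht μ hh,
    restrictSphere_ballLift_self ht μ hg] at e
  rw [cubeToSphere_injOn n t hh.1 hg.1 e]

theorem finrank_ballW {r t : ℕ} (hr : 2 * r ≤ n) (ht : t ≤ r) (μ : ℝ) :
    (Module.finrank ℝ (ballW n r t μ) : ℤ) = binomDiff n t := by
  have hinj : Function.Injective
      ((cubeToBall n r ∘ₗ ballLift n r t μ).domRestrict (cubeHarmonic n t)) := by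
    intro h g e
    have e' := congrArg (restrictSphere n ht) e
    rw [LinearMap.domRestrict_apply, LinearMap.domRestrict_apply, LinearMap.comp_apply,
      LinearMap.comp_apply, restrictSphere_ballLift_self ht μ h.2,
      restrictSphere_ballLift_self ht μ g.2] at e'
    exact Subtype.ext (cubeToSphere_injOn n t h.2.1 g.2.1 e')
  rw [← finrank_cubeHarmonic (n := n) (t := t) (by omega), ballW, ← LinearMap.range_domRestrict,
    LinearMap.finrank_range_of_inj hinj]

end BallEigenspace

/-! ### Dimension count and the spectrum. -/

theorem sum_finrank_le_of_indep {V ι : Type*} [AddCommGroup V] [Module ℝ V] [FiniteDimensional ℝ V]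
    (s : Finset ι) (W : ι → Submodule ℝ V) (E : Submodule ℝ V) (hE : ∀ i ∈ s, W i ≤ E)
    (hW : ∀ v : ι → V, (∀ i ∈ s, v i ∈ W i) → ∑ i ∈ s, v i = 0 → ∀ i ∈ s, v i = 0) :
    ∑ i ∈ s, Module.finrank ℝ (W i) ≤ Module.finrank ℝ E := by
  classical
  let T : ((i : s) → W i) →ₗ[ℝ] E := (∑ i : s, (W i).subtype ∘ₗ LinearMap.proj i).codRestrict E
    fun v => by
      rw [LinearMap.sum_apply]
      exact Submodule.sum_mem _ fun i _ => hE i i.2 (v i).2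
  have hT : Function.Injective T := by
    rw [injective_iff_map_eq_zero]
    intro v hv
    have h1 : ∑ i : s, (v i : V) = 0 := by
      have := congrArg Subtype.val hv
      simpa [T, LinearMap.sum_apply] using this
    let w : ι → V := fun i => if h : i ∈ s then (v ⟨i, h⟩ : V) else 0
    have hw (i : s) : w i = v i := dif_pos i.2
    have h2 : ∑ i ∈ s, w i = 0 := by
      rw [← Finset.sum_coe_sort, ← h1]
      exact Finset.sum_congr rfl fun i _ => hw i
    funext i
    refine Subtype.ext ?_
    rw [← hw i]
    exact hW w (fun j hj => by rw [hw ⟨j, hj⟩]; exact (v ⟨j, hj⟩).2) h2 i i.2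
  have := LinearMap.finrank_le_finrank_of_injective hT
  rwa [Module.finrank_pi_fintype, Finset.sum_coe_sort s fun i => Module.finrank ℝ (W i)] at this

theorem sum_binomDiff (n t : ℕ) :
    ∑ s ∈ Finset.range (t + 1), binomDiff n s = n.choose t := by
  induction t with
  | zero => simp [binomDiff]
  | succ t ih => rw [Finset.sum_range_succ, ih, binomDiff]; ring

/-- Writing binom(n,i) as the telescoping sum of the differences up to i, the t-th difference occurs
for i = t, ..., r. The right side is |B(n,r)|. -/
theorem sum_mul_binomDiff (n r : ℕ) :
    ∑ t ∈ Finset.range (r + 1), ((r - t + 1 : ℕ) : ℤ) * binomDiff n t =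
      ∑ t ∈ Finset.range (r + 1), (n.choose t : ℤ) := by
  induction r with
  | zero => simp [binomDiff]
  | succ r ih =>
    rw [Finset.sum_range_succ, Finset.sum_range_succ (fun t => (n.choose t : ℤ)), ← ih,
      ← sum_binomDiff, Finset.sum_range_succ (binomDiff n), ← add_assoc,
      ← Finset.sum_add_distrib]
    congr 1
    · refine Finset.sum_congr rfl fun t ht => ?_
      rw [Finset.mem_range] at ht
      have : r + 1 - t + 1 = (r - t + 1) + 1 := by omega
      rw [this]
      push_cast
      ring
    · simp

section BallSpectrum

variable {n r : ℕ}

/-- Triangularity: on S(n,t) the components of larger index vanish and those of smaller index are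
zero by induction, so the t-th one restricts to zero and hence is zero. -/
theorem ballW_indep (μ : ℝ) (s : Finset ℕ) (hs : ∀ t ∈ s, t ≤ r) (v : ℕ → hBall n r → ℝ)
    (hv : ∀ t ∈ s, v t ∈ ballW n r t μ) (h0 : ∑ t ∈ s, v t = 0) : ∀ t ∈ s, v t = 0 := by
  intro t
  induction t using Nat.strong_induction_on with
  | _ t ih =>
    intro ht
    refine injOn_restrictSphere_ballW (hs t ht) μ (hv t ht) (Submodule.zero_mem _) ?_
    funext x
    have hx : hWeight x.1 = t := x.2
    have h1 := congrFun h0 (Set.inclusion (hSphere_subset_hBall n (hs t ht)) x)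
    rw [Finset.sum_apply, Finset.sum_eq_single t] at h1
    · simpa [restrictSphere, LinearMap.funLeft_apply] using h1
    · intro i hi hit
      rcases lt_or_gt_of_ne hit with h | h
      · rw [ih i h hi]; rfl
      · exact ballW_apply_of_lt (hv i hi) _ (by simpa [hx] using h)
    · exact fun h => absurd ht h

theorem ballLambda_finite {t : ℕ} (ht : t ≤ r) (hr : 2 * r ≤ n) : (ballLambda n r t).Finite :=
  Set.finite_of_ncard_pos (by rw [ballLambda_ncard ht hr]; omega)

open Classical in
theorem lambdaDimSum_le_finrank (hr : 2 * r ≤ n) (μ : ℝ) :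
    lambdaDimSum n r μ ≤ Module.finrank ℝ (Module.End.eigenspace (hBallOp n r) μ) := by
  set s := (Finset.range (r + 1)).filter (fun t => μ ∈ ballLambda n r t) with hs
  have hsr : ∀ t ∈ s, t ≤ r := fun t ht =>
    Nat.lt_succ_iff.1 (Finset.mem_range.1 (Finset.mem_filter.1 ht).1)
  have h := sum_finrank_le_of_indep s (fun t => ballW n r t μ)
    (Module.End.eigenspace (hBallOp n r) μ)
    (fun t ht => ballW_le_eigenspace hr (hsr t ht) (Finset.mem_filter.1 ht).2)
    (ballW_indep μ s hsr)
  have e : lambdaDimSum n r μ = ((∑ t ∈ s, Module.finrank ℝ (ballW n r t μ) : ℕ) : ℤ) := by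
    rw [lambdaDimSum, Nat.cast_sum]
    exact Finset.sum_congr rfl fun t ht => (finrank_ballW hr (hsr t ht) μ).symm
  rw [e]
  exact_mod_cast h

open Classical in
theorem sum_lambdaDimSum (hr : 2 * r ≤ n) (S : Finset ℝ)
    (hS : ∀ t ≤ r, ballLambda n r t ⊆ S) :
    ∑ μ ∈ S, lambdaDimSum n r μ = ∑ t ∈ Finset.range (r + 1), (n.choose t : ℤ) := by
  simp only [lambdaDimSum, Finset.sum_filter]
  rw [Finset.sum_comm, ← sum_mul_binomDiff]
  refine Finset.sum_congr rfl fun t ht => ?_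
  have ht' : t ≤ r := Nat.lt_succ_iff.1 (Finset.mem_range.1 ht)
  rw [← Finset.sum_filter, Finset.sum_const, nsmul_eq_mul, ← ballLambda_ncard ht' hr,
    ← Set.ncard_coe_finset]
  congr 3
  ext μ
  simpa using fun h => hS t ht' h

open Classical in
theorem finrank_eigenspace_hBallOp (hr : 2 * r ≤ n) (μ : ℝ) :
    (Module.finrank ℝ (Module.End.eigenspace (hBallOp n r) μ) : ℤ) = lambdaDimSum n r μ := by
  have hfin : (⋃ t ∈ Set.Iic r, ballLambda n r t).Finite :=
    (Set.finite_Iic r).biUnion fun t ht => ballLambda_finite ht hr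
  -- Inserting μ makes the termwise equality below apply to every real μ, including those in no Λ_t.
  set S : Finset ℝ := insert μ hfin.toFinset with hSdef
  have hS : ∀ t ≤ r, ballLambda n r t ⊆ S := by
    intro t ht x hx
    simp only [hSdef, Finset.coe_insert, Set.Finite.coe_toFinset]
    exact Set.mem_insert_of_mem _ (Set.mem_biUnion (Set.mem_Iic.2 ht) hx)
  have hle : ∑ x ∈ S, Module.finrank ℝ (Module.End.eigenspace (hBallOp n r) x) ≤
      Module.finrank ℝ (⊤ : Submodule ℝ (hBall n r → ℝ)) :=
    sum_finrank_le_of_indep S _ ⊤ (fun _ _ => le_top)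
      (iSupIndep_iff_finsetSum_eq_zero_imp_eq_zero _ |>.1
        (Module.End.eigenspaces_iSupIndep (hBallOp n r)) S)
  rw [finrank_top, Module.finrank_fintype_fun_eq_card, card_hBall] at hle
  have hsum := sum_lambdaDimSum hr S hS
  have heq : ∑ x ∈ S, lambdaDimSum n r x =
      ∑ x ∈ S, (Module.finrank ℝ (Module.End.eigenspace (hBallOp n r) x) : ℤ) :=
    le_antisymm (Finset.sum_le_sum fun x _ => lambdaDimSum_le_finrank hr x)
      (by rw [hsum]; exact_mod_cast hle)
  exact ((Finset.sum_eq_sum_iff_of_le fun x _ => lambdaDimSum_le_finrank hr x).1 heq μ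
    (Finset.mem_insert_self _ _)).symm

open Classical in
theorem lambdaDimSum_ne_zero_iff (hr : 2 * r ≤ n) (μ : ℝ) :
    lambdaDimSum n r μ ≠ 0 ↔ ∃ t ≤ r, μ ∈ ballLambda n r t := by
  have hpos : ∀ t ∈ (Finset.range (r + 1)).filter (fun t => μ ∈ ballLambda n r t),
      0 < binomDiff n t := by
    intro t ht
    have := Finset.mem_range.1 (Finset.mem_filter.1 ht).1
    exact binomDiff_pos (by omega)
  rw [lambdaDimSum, Ne, Finset.sum_eq_zero_iff_of_nonneg fun t ht => (hpos t ht).le]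
  constructor
  · intro h
    push Not at h
    obtain ⟨t, ht, -⟩ := h
    exact ⟨t, Nat.lt_succ_iff.1 (Finset.mem_range.1 (Finset.mem_filter.1 ht).1),
      (Finset.mem_filter.1 ht).2⟩
  · rintro ⟨t, ht, hμ⟩ h
    have hmem : t ∈ (Finset.range (r + 1)).filter (fun t => μ ∈ ballLambda n r t) :=
      Finset.mem_filter.2 ⟨Finset.mem_range.2 (Nat.lt_succ_iff.2 ht), hμ⟩
    exact (hpos t hmem).ne' (h t hmem)

end BallSpectrum

theorem theorem1p5 (n r : ℕ) (hr : 2 * r ≤ n) :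
    (∃ W : ℕ → ℝ → Submodule ℝ (hBall n r → ℝ),
      ∀ (t : ℕ) (ht : t ≤ r),
        (ballLambda n r t).ncard = r - t + 1 ∧
        ∀ μ ∈ ballLambda n r t,
          W t μ ≤ Module.End.eigenspace (hBallOp n r) μ ∧
          (Module.finrank ℝ (W t μ) : ℤ) = binomDiff n t ∧
          (∀ f ∈ W t μ, ∀ x : hBall n r, hWeight x.1 < t → f x = 0) ∧
          (∀ f ∈ W t μ, ∀ (i : ℕ) (hi : i ≤ r), t ≤ i →
            restrictSphere n hi f ∈ johnsonV n i t) ∧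
          Submodule.map (restrictSphere n ht) (W t μ) = johnsonV n t t ∧
          Set.InjOn (restrictSphere n ht) (W t μ : Set (hBall n r → ℝ))) ∧
    (∀ μ : ℝ, Module.End.HasEigenvalue (hBallOp n r) μ ↔ ∃ t ≤ r, μ ∈ ballLambda n r t) ∧
    (∀ μ : ℝ, (Module.finrank ℝ (Module.End.eigenspace (hBallOp n r) μ) : ℤ)
      = lambdaDimSum n r μ) := by
  refine ⟨⟨ballW n r, fun t ht => ⟨ballLambda_ncard ht hr, fun μ hμ =>
    ⟨ballW_le_eigenspace hr ht hμ, finrank_ballW hr ht μ,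
      fun f hf x hx => ballW_apply_of_lt hf x hx,
      fun f hf i hi hti => restrictSphere_mem_johnsonV hf hi hti,
      map_restrictSphere_ballW ht μ, injOn_restrictSphere_ballW ht μ⟩⟩⟩, fun μ => ?_,
    finrank_eigenspace_hBallOp hr⟩
  rw [← lambdaDimSum_ne_zero_iff hr, ← finrank_eigenspace_hBallOp hr, Nat.cast_ne_zero,
    Module.End.hasEigenvalue_iff, Ne, Ne, Submodule.finrank_eq_zero]
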